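/- Let $0\le d\le p$ be integers. Say that a random vector $\mathbf{x}\in\mathbb{R}^p$ follows the signal separation model with parameters $(\boldsymbol\mu,\boldsymbol\Omega)$, where $\boldsymbol\mu\in\mathbb{R}^p$ and $\boldsymbol\Omega=(\boldsymbol\Omega_1,\boldsymbol\Omega_2)\in\mathbb{R}^{p\times p}$ is non-singular with $\boldsymbol\Omega_1\in\mathbb{R}^{p\times d}$ and $\boldsymbol\Omega_2\in\mathbb{R}^{p\times(p-d)}$, if almost surely $$\mathbf{x}=\boldsymbol\mu+\boldsymbol\Omega\mathbf{z}=\boldsymbol\mu+\boldsymbol\Omega_1\mathbf{s}+\boldsymbol\Omega_2\mathbf{n},\qquad \mathbf{z}=\begin{pmatrix}\mathbf{s}\\ \mathbf{n}\end{pmatrix},\quad \mathbf{s}\in\mathbb{R}^d,\ \mathbf{n}\in\mathbb{R}^{p-d},$$ where the components $z_1,\dots,z_p$ of the random vector $\mathbf{z}$ are mutually independent and standardized ($E(z_k)=0$ and $E(z_k^2)=1$ for all $k$), every component of $\mathbf{s}$ is non-Gaussian and every component of $\mathbf{n}$ is Gaussian. Then $\boldsymbol\Omega_1$ is identified by the distribution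 of $\mathbf{x}$ up to the signs and the permutation of its columns: if $\mathbf{x}$ follows the model with parameters $(\boldsymbol\mu,\boldsymbol\Omega)$, $\mathbf{x}^*$ follows the model with parameters $(\boldsymbol\mu^*,\boldsymbol\Omega^*)$ (with the same $p$ and $d$, the two vectors being possibly defined on different probability spaces), and $\mathbf{x}$ and $\mathbf{x}^*$ have the same distribution, then there are a permutation $\sigma$ of $\{1,\dots,d\}$ and signs $\varepsilon_1,\dots,\varepsilon_d\in\{-1,1\}$ such that, for every $j=1,\dots,d$, the $j$-th column of $\boldsymbol\Omega_1^*$ is $\varepsilon_j$ times the $\sigma(j)$-th column of $\boldsymbol\Omega_1$. -/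

import Mathlib

open MeasureTheory ProbabilityTheory

/-- The random vector `x` follows the signal separation model `x = μ + Ω z` on the probability
space `(S, P)`, with `Ω` non-singular and `z = (s, n)`, where `s` consists of the first `d`
components of `z` and `n` of the remaining `p - d` ones:
the components of `z` are mutually independent and standardized (mean zero, unit variance), those
of `s` are non-Gaussian and those of `n` are Gaussian. -/
structure IsSignalSeparationModel {S : Type*} [MeasurableSpace S] (P : Measure S) {p : ℕ} (d : ℕ)
    (μ : Fin p → ℝ) (Ω : Matrix (Fin p) (Fin p) ℝ) (z x : S → Fin p → ℝ) : Prop where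
  nonsingular : IsUnit Ω.det
  indep : iIndepFun (fun (k : Fin p) (ω : S) => z ω k) P
  memLp : ∀ k : Fin p, MemLp (fun ω => z ω k) 2 P
  mean_eq_zero : ∀ k : Fin p, ∫ ω, z ω k ∂P = 0
  second_moment_eq_one : ∀ k : Fin p, ∫ ω, z ω k ^ 2 ∂P = 1
  signal_nonGaussian : ∀ k : Fin p, k.val < d → ¬ HasGaussianLaw (fun ω => z ω k) P
  noise_gaussian : ∀ k : Fin p, d ≤ k.val → HasGaussianLaw (fun ω => z ω k) P
  observed_eq : ∀ᵐ ω ∂P, x ω = μ + Ω.mulVec (z ω)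

/-- The block `Ω₁` in `Ω = (Ω₁, Ω₂)`, made of the first `d` columns of `Ω`. -/
def signalBlock {p d : ℕ} (hd : d ≤ p) (Ω : Matrix (Fin p) (Fin p) ℝ) :
    Matrix (Fin p) (Fin d) ℝ :=
  Ω.submatrix id (Fin.castLE hd)

/-!
Put `A = Ω'⁻¹ Ω`. Then `y = A z` has the law of `z'`, so `z` and `y` both have independent
coordinates of variance one, and `A` is orthogonal. Take `i ≠ j`. Since `z` is a linear function of
`y`, tilting the probability by `exp (i t zₖ)` preserves the factorization over the coordinates of
`y`, so the tilted covariance of `yᵢ` and `yⱼ` vanishes. Expanded in the coordinates of `z`, it is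
the sum over `l` of `Aᵢₗ Aⱼₗ` times the tilted variance of `zₗ`, which does not depend on `t` for
`l ≠ k` and is `-(log φₖ)''(t)` for `l = k`, where `φₖ` is the characteristic function of `zₖ`.
Hence, if `Aᵢₖ Aⱼₖ ≠ 0`, then `(log φₖ)''` is constant and `zₖ` is Gaussian. At a non-Gaussian
source `k` the column `k` of `A` therefore has a single nonzero entry, which is `±1` and is also
alone in its row `i`; then `yᵢ = ± zₖ` is not Gaussian, so `i` is the index of a signal of the
second model.
-/

open scoped Matrix NNReal

section LogDerivative

lemma eq_of_mul_deriv_deriv_eq_sq {𝕜 : Type*} [RCLike 𝕜] {f f' f'' : ℝ → 𝕜}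
    (hf : ∀ t, HasDerivAt f (f' t) t) (hf' : ∀ t, HasDerivAt f' (f'' t) t)
    (h : ∀ t, f t * f'' t = f' t ^ 2) {a : ℝ} (ha : f a ≠ 0) (ha' : f' a = 0) (t : ℝ) :
    f t = f a := by
  have hf_cont : Continuous f := continuous_iff_continuousAt.2 fun t ↦ (hf t).continuousAt
  have hf'_cont : Continuous f' := continuous_iff_continuousAt.2 fun t ↦ (hf' t).continuousAt
  have hquot (s : ℝ) (hs : f s ≠ 0) : HasDerivAt (fun s ↦ f' s / f s) 0 s := by
    refine ((hf' s).div (hf s) hs).congr_deriv ?_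
    rw [div_eq_zero_iff]
    exact .inl (by linear_combination h s)
  -- Where `f ≠ 0`, the equation says that `f' / f` is locally constant.
  have hopen : IsOpen ({s | f s ≠ 0} ∩ (fun s ↦ f' s / f s) ⁻¹' {0}) :=
    (isOpen_ne_fun hf_cont continuous_const).isOpen_inter_preimage_of_deriv_eq_zero
      (fun s hs ↦ (hquot s hs).differentiableAt.differentiableWithinAt)
      (fun s hs ↦ (hquot s hs).deriv) {0}
  have hopen_const : IsOpen (({s | f s ≠ 0} ∩ (fun s ↦ f' s / f s) ⁻¹' {0}) ∩ f ⁻¹' {f a}) := by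
    refine hopen.isOpen_inter_preimage_of_deriv_eq_zero
      (fun s _ ↦ (hf s).differentiableAt.differentiableWithinAt) (fun s hs ↦ ?_) {f a}
    rw [(hf s).deriv]
    exact (div_eq_zero_iff.1 hs.2).resolve_right hs.1
  have hset : ({s | f s ≠ 0} ∩ (fun s ↦ f' s / f s) ⁻¹' {0}) ∩ f ⁻¹' {f a} =
      {s | f' s = 0} ∩ {s | f s = f a} := by
    ext s
    simp only [Set.mem_inter_iff, Set.mem_ofPred_eq, Set.mem_preimage, Set.mem_singleton_iff,
      div_eq_zero_iff]
    grind
  have hclosed : IsClosed ({s | f' s = 0} ∩ {s | f s = f a}) :=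
    (isClosed_eq hf'_cont continuous_const).inter (isClosed_eq hf_cont continuous_const)
  have huniv : {s | f' s = 0} ∩ {s | f s = f a} = Set.univ :=
    IsClopen.eq_univ ⟨hclosed, hset ▸ hopen_const⟩ ⟨a, ha', rfl⟩
  exact (huniv.ge (Set.mem_univ t)).2

lemma eq_cexp_of_mul_deriv_deriv_sub_sq {f f' f'' : ℝ → ℂ} {c : ℂ}
    (hf : ∀ t, HasDerivAt f (f' t) t) (hf' : ∀ t, HasDerivAt f' (f'' t) t)
    (h : ∀ t, f t * f'' t - f' t ^ 2 = c * f t ^ 2) (h0 : f 0 = 1) (t : ℝ) :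
    f t = Complex.exp (f' 0 * t + c * t ^ 2 / 2) := by
  -- Multiplying `f` by `E`, the inverse of the claimed solution, reduces to the case `c = 0`.
  set q : ℝ → ℂ := fun s ↦ f' 0 + c * s with hq
  set E : ℝ → ℂ := fun s ↦ Complex.exp (-(f' 0 * s + c * s ^ 2 / 2)) with hE
  have hid (s : ℝ) : HasDerivAt (fun s : ℝ ↦ (s : ℂ)) 1 s := Complex.ofRealCLM.hasDerivAt
  have hqd (s : ℝ) : HasDerivAt q c s :=
    (((hid s).const_mul c).const_add (f' 0)).congr_deriv (mul_one c)
  have hEd (s : ℝ) : HasDerivAt E (-q s * E s) s := by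
    refine (((hid s).const_mul (f' 0)).add
      ((((hid s).pow 2).const_mul c).div_const 2)).neg.cexp.congr_deriv ?_
    simp only [hq, hE, Pi.add_apply, Pi.pow_apply, Pi.neg_apply]
    ring
  have hg (s : ℝ) : HasDerivAt (fun s ↦ f s * E s) ((f' s - q s * f s) * E s) s :=
    ((hf s).mul (hEd s)).congr_deriv (by ring)
  have hg' (s : ℝ) : HasDerivAt (fun s ↦ (f' s - q s * f s) * E s)
      ((f'' s - 2 * q s * f' s - c * f s + q s ^ 2 * f s) * E s) s :=
    (((hf' s).sub ((hqd s).mul (hf s))).mul (hEd s)).congr_deriv (by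
      simp only [Pi.sub_apply, Pi.mul_apply]; ring)
  have hconst : f t * E t = f 0 * E 0 :=
    eq_of_mul_deriv_deriv_eq_sq hg hg' (fun s ↦ by linear_combination E s ^ 2 * h s)
      (by simp [h0, hE]) (by simp [h0, hq]) t
  rw [hE] at hconst
  simp only [Complex.exp_neg, h0] at hconst
  simpa [Complex.exp_ne_zero, mul_inv_eq_one₀] using hconst

end LogDerivative

section TiltedCov

variable {S : Type*} {mS : MeasurableSpace S} {P : Measure S} {W X Y : S → ℝ}

/-- The covariance of `X` and `Y` under the complex tilt `exp (iW) dP`, multiplied by the square of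
`φ = ∫ exp (iW) dP` so that no division occurs where `φ` vanishes. With
`φ (s, t) = ∫ exp (i (W + s X + t Y)) dP` it is the value at `0` of
`∂ₛφ ∂ₜφ - φ ∂ₛ∂ₜφ = - φ² ∂ₛ∂ₜ log φ`. -/
noncomputable def tiltedCov (P : Measure S) (W X Y : S → ℝ) : ℂ :=
  (∫ ω, X ω * Y ω * Complex.exp (W ω * Complex.I) ∂P) * ∫ ω, Complex.exp (W ω * Complex.I) ∂P
    - (∫ ω, X ω * Complex.exp (W ω * Complex.I) ∂P) *
      ∫ ω, Y ω * Complex.exp (W ω * Complex.I) ∂P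

lemma integrable_ofReal_mul_cexp (hX : Integrable X P) (hW : AEMeasurable W P) :
    Integrable (fun ω ↦ X ω * Complex.exp (W ω * Complex.I)) P := by
  refine hX.ofReal.mul_bdd (c := 1) (AEMeasurable.aestronglyMeasurable (by fun_prop)) ?_
  exact .of_forall fun ω ↦ (Complex.norm_exp_ofReal_mul_I _).le

lemma tiltedCov_comm (W X Y : S → ℝ) : tiltedCov P W X Y = tiltedCov P W Y X := by
  simp only [tiltedCov, mul_comm]

lemma tiltedCov_dotProduct_left [IsFiniteMeasure P] {ι : Type*} [Fintype ι] {z : S → ι → ℝ}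
    (hz : ∀ k, MemLp (z · k) 2 P) (hY : MemLp Y 2 P) (hW : AEMeasurable W P) (a : ι → ℝ) :
    tiltedCov P W (a ⬝ᵥ z ·) Y = ∑ k, a k * tiltedCov P W (z · k) Y := by
  have hz_int (k : ι) : Integrable (fun ω ↦ z ω k * Complex.exp (W ω * Complex.I)) P :=
    integrable_ofReal_mul_cexp ((hz k).integrable one_le_two) hW
  have hzY_int (k : ι) : Integrable (fun ω ↦ z ω k * Y ω * Complex.exp (W ω * Complex.I)) P := by
    simpa using integrable_ofReal_mul_cexp ((hz k).integrable_mul hY) hW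
  have hz_sum : ∫ ω, ↑(a ⬝ᵥ z ω) * Complex.exp (W ω * Complex.I) ∂P =
      ∑ k, a k * ∫ ω, z ω k * Complex.exp (W ω * Complex.I) ∂P := by
    simp only [dotProduct, Complex.ofReal_sum, Complex.ofReal_mul, Finset.sum_mul, mul_assoc]
    rw [integral_finsetSum _ fun k _ ↦ (hz_int k).const_mul _]
    simp only [integral_const_mul]
  have hzY_sum : ∫ ω, ↑(a ⬝ᵥ z ω) * Y ω * Complex.exp (W ω * Complex.I) ∂P =
      ∑ k, a k * ∫ ω, z ω k * Y ω * Complex.exp (W ω * Complex.I) ∂P := by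
    simp only [mul_assoc] at hzY_int
    simp only [dotProduct, Complex.ofReal_sum, Complex.ofReal_mul, Finset.sum_mul, mul_assoc]
    rw [integral_finsetSum _ fun k _ ↦ (hzY_int k).const_mul _]
    simp only [integral_const_mul]
  rw [tiltedCov, hz_sum, hzY_sum]
  simp only [tiltedCov, mul_sub, Finset.sum_mul, Finset.sum_sub_distrib, mul_assoc]

lemma tiltedCov_eq_covariance_mul_sq [IsProbabilityMeasure P] (hX : MemLp X 2 P)
    (hY : MemLp Y 2 P) (hW : AEMeasurable W P) (h : IndepFun (fun ω ↦ (X ω, Y ω)) W P) :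
    tiltedCov P W X Y = cov[X, Y; P] * (∫ ω, Complex.exp (W ω * Complex.I) ∂P) ^ 2 := by
  have hfactor {g : ℝ × ℝ → ℝ} (hg : Measurable g) :
      ∫ ω, g (X ω, Y ω) * Complex.exp (W ω * Complex.I) ∂P =
        ↑(∫ ω, g (X ω, Y ω) ∂P) * ∫ ω, Complex.exp (W ω * Complex.I) ∂P := by
    rw [← integral_complex_ofReal]
    exact h.integral_fun_comp_mul_comp (f := fun x ↦ (g x : ℂ))
      (g := fun w : ℝ ↦ Complex.exp (w * Complex.I))
      (hX.aestronglyMeasurable.aemeasurable.prodMk hY.aestronglyMeasurable.aemeasurable) hW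
      (by fun_prop) (by fun_prop)
  have hXY := hfactor (g := fun x ↦ x.1 * x.2) (by fun_prop)
  push_cast at hXY
  rw [tiltedCov, hXY, hfactor measurable_fst, hfactor measurable_snd, covariance_eq_sub hX hY]
  push_cast
  simp only [Pi.mul_apply]
  ring

lemma tiltedCov_zero [IsProbabilityMeasure P] (hX : MemLp X 2 P) (hY : MemLp Y 2 P) :
    tiltedCov P (fun _ ↦ 0) X Y = cov[X, Y; P] := by
  rw [tiltedCov_eq_covariance_mul_sq hX hY aemeasurable_const (indepFun_const_right _ 0)]
  simp

lemma tiltedCov_dotProduct_eq_zero {ι : Type*} [Fintype ι] {z : S → ι → ℝ}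
    (hz : iIndepFun (fun k ω ↦ z ω k) P) (hzm : ∀ k, AEMeasurable (z · k) P) (c : ι → ℝ)
    {l m : ι} (hlm : l ≠ m) : tiltedCov P (c ⬝ᵥ z ·) (z · l) (z · m) = 0 := by
  classical
  have hexp (ω : S) : Complex.exp (↑(c ⬝ᵥ z ω) * Complex.I) =
      ∏ k, Complex.exp (c k * z ω k * Complex.I) := by
    rw [← Complex.exp_sum, ← Finset.sum_mul, dotProduct]
    push_cast
    rfl
  have hfactor (n : ι → ℕ) :
      ∫ ω, (∏ k, (z ω k : ℂ) ^ n k) * Complex.exp (↑(c ⬝ᵥ z ω) * Complex.I) ∂P =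
        ∏ k, ∫ ω, (z ω k : ℂ) ^ n k * Complex.exp (c k * z ω k * Complex.I) ∂P := by
    simp_rw [hexp, ← Finset.prod_mul_distrib]
    exact hz.integral_fun_prod_comp hzm
      (f := fun k (x : ℝ) ↦ (x : ℂ) ^ n k * Complex.exp (c k * x * Complex.I))
      fun k ↦ by fun_prop
  have hsingle (ω : S) (k : ι) : ∏ j, (z ω j : ℂ) ^ (Pi.single k 1 : ι → ℕ) j = z ω k := by
    simp [Pi.single_apply, pow_ite]
  have h0 := hfactor 0
  have hl := hfactor (Pi.single l 1)
  have hm := hfactor (Pi.single m 1)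
  have hprod := hfactor (Pi.single l 1 + Pi.single m 1)
  simp only [Pi.add_apply, pow_add, Finset.prod_mul_distrib, hsingle, Pi.zero_apply, pow_zero,
    Finset.prod_const_one, one_mul] at h0 hl hm hprod
  -- Coordinate by coordinate both sides have the same two factors, swapped at `m`.
  rw [tiltedCov, h0, hl, hm, hprod, sub_eq_zero, ← Finset.prod_mul_distrib,
    ← Finset.prod_mul_distrib]
  refine Finset.prod_congr rfl fun k _ ↦ ?_
  rcases eq_or_ne k l with rfl | hkl
  · simp [hlm]
  · simp [hkl, mul_comm]

lemma tiltedCov_dotProduct_dotProduct {ι : Type*} [Fintype ι] {z : S → ι → ℝ}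
    (hz : iIndepFun (fun k ω ↦ z ω k) P) (hz2 : ∀ k, MemLp (z · k) 2 P) (c a b : ι → ℝ) :
    tiltedCov P (c ⬝ᵥ z ·) (a ⬝ᵥ z ·) (b ⬝ᵥ z ·) =
      ∑ k, a k * b k * tiltedCov P (c ⬝ᵥ z ·) (z · k) (z · k) := by
  have := hz.isProbabilityMeasure
  have hzm (k : ι) : AEMeasurable (z · k) P := (hz2 k).aemeasurable
  have hW : AEMeasurable (c ⬝ᵥ z ·) P := Finset.aemeasurable_fun_sum _ fun k _ ↦ (hzm k).const_mul _
  have hb : MemLp (b ⬝ᵥ z ·) 2 P := memLp_finsetSum _ fun k _ ↦ (hz2 k).const_mul _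
  rw [tiltedCov_dotProduct_left hz2 hb hW]
  refine Finset.sum_congr rfl fun k _ ↦ ?_
  rw [tiltedCov_comm, tiltedCov_dotProduct_left hz2 (hz2 k) hW,
    Finset.sum_eq_single k (fun l _ hlk ↦ by simp [tiltedCov_dotProduct_eq_zero hz hzm c hlk])
      (by simp), mul_assoc]

end TiltedCov

section Gaussian

lemma eq_gaussianReal_of_charFun_mul_iteratedDeriv_two {μ : Measure ℝ} [IsProbabilityMeasure μ]
    (hμ : MemLp id 2 μ) {v : ℝ≥0}
    (h : ∀ t, charFun μ t * iteratedDeriv 2 (charFun μ) t - iteratedDeriv 1 (charFun μ) t ^ 2 =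
      -v * charFun μ t ^ 2) :
    μ = gaussianReal μ[id] v := by
  have hcontDiff : ContDiff ℝ 2 (charFun μ) := contDiff_charFun (n := 2) hμ
  have hderiv (t : ℝ) : HasDerivAt (charFun μ) (iteratedDeriv 1 (charFun μ) t) t := by
    rw [iteratedDeriv_one]
    exact (hcontDiff.differentiable two_ne_zero t).hasDerivAt
  have hderiv' (t : ℝ) :
      HasDerivAt (iteratedDeriv 1 (charFun μ)) (iteratedDeriv 2 (charFun μ) t) t := by
    rw [iteratedDeriv_succ (n := 1)]
    exact (hcontDiff.differentiable_iteratedDeriv 1 (by norm_num) t).hasDerivAt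
  have hderiv_zero : iteratedDeriv 1 (charFun μ) 0 = Complex.I * (μ[id] : ℝ) := by
    rw [iteratedDeriv_charFun_zero (by exact_mod_cast hμ.mono_exponent one_le_two)]
    simp
  refine Measure.ext_of_charFun (funext fun t ↦ ?_)
  rw [eq_cexp_of_mul_deriv_deriv_sub_sq hderiv hderiv' h (by simp), charFun_gaussianReal,
    hderiv_zero]
  ring_nf

variable {S : Type*} {mS : MeasurableSpace S} {P : Measure S} {X : S → ℝ}

lemma charFun_map_eq_integral (hX : AEMeasurable X P) (t : ℝ) :
    charFun (P.map X) t = ∫ ω, Complex.exp (↑(t * X ω) * Complex.I) ∂P := by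
  rw [charFun_apply_real, integral_map hX (by fun_prop)]
  simp

lemma charFun_map_mul_iteratedDeriv_two_sub_sq [IsFiniteMeasure P] (hX : MemLp X 2 P) (t : ℝ) :
    charFun (P.map X) t * iteratedDeriv 2 (charFun (P.map X)) t
        - iteratedDeriv 1 (charFun (P.map X)) t ^ 2 =
      -tiltedCov P (fun ω ↦ t * X ω) X X := by
  have hid : MemLp id 2 (P.map X) := (memLp_map_measure_iff (by fun_prop) hX.aemeasurable).2 hX
  have hderiv : iteratedDeriv 1 (charFun (P.map X)) t =
      Complex.I * ∫ ω, X ω * Complex.exp (↑(t * X ω) * Complex.I) ∂P := by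
    rw [iteratedDeriv_charFun (by exact_mod_cast hid.mono_exponent one_le_two),
      integral_map hX.aemeasurable (by fun_prop)]
    simp
  have hderiv₂ : iteratedDeriv 2 (charFun (P.map X)) t =
      -∫ ω, X ω * X ω * Complex.exp (↑(t * X ω) * Complex.I) ∂P := by
    rw [iteratedDeriv_charFun (by exact_mod_cast hid),
      integral_map hX.aemeasurable (by fun_prop)]
    simp [sq]
  rw [charFun_map_eq_integral hX.aemeasurable, hderiv, hderiv₂, mul_pow, Complex.I_sq, tiltedCov]
  ring

lemma hasGaussianLaw_of_tiltedCov_self_eq [IsProbabilityMeasure P] (hX : MemLp X 2 P) {c : ℂ}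
    (h : ∀ t : ℝ, tiltedCov P (fun ω ↦ t * X ω) X X =
      c * (∫ ω, Complex.exp (↑(t * X ω) * Complex.I) ∂P) ^ 2) :
    HasGaussianLaw X P := by
  have hc : c = Var[X; P].toNNReal := by
    rw [Real.coe_toNNReal _ (variance_nonneg _ _)]
    simpa [tiltedCov_zero hX hX, covariance_self hX.aemeasurable] using (h 0).symm
  have : IsProbabilityMeasure (P.map X) := Measure.isProbabilityMeasure_map hX.aemeasurable
  have hode (t : ℝ) := charFun_map_mul_iteratedDeriv_two_sub_sq hX t
  simp_rw [h, ← charFun_map_eq_integral hX.aemeasurable, ← neg_mul, hc] at hode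
  have hmap := eq_gaussianReal_of_charFun_mul_iteratedDeriv_two
    ((memLp_map_measure_iff (by fun_prop) hX.aemeasurable).2 hX) hode
  exact ⟨hmap ▸ inferInstance⟩

theorem hasGaussianLaw_of_iIndepFun_mulVec {ι κ : Type*} [Fintype ι] [DecidableEq ι] [Fintype κ]
    {z : S → ι → ℝ} (hz : iIndepFun (fun k ω ↦ z ω k) P) (hz2 : ∀ k, MemLp (z · k) 2 P)
    {A : Matrix κ ι ℝ} {B : Matrix ι κ ℝ} (hBA : B * A = 1)
    (hy : iIndepFun (fun i ω ↦ (A *ᵥ z ω) i) P) {i j : κ} (hij : i ≠ j) {k : ι}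
    (hk : A i k * A j k ≠ 0) : HasGaussianLaw (z · k) P := by
  have := hz.isProbabilityMeasure
  have hzm (l : ι) : AEMeasurable (z · l) P := (hz2 l).aemeasurable
  have hym (i : κ) : AEMeasurable (fun ω ↦ (A *ᵥ z ω) i) P :=
    Finset.aemeasurable_fun_sum _ fun l _ ↦ (hzm l).const_mul _
  refine hasGaussianLaw_of_tiltedCov_self_eq (hz2 k)
    (c := -(∑ l ∈ Finset.univ.erase k, A i l * A j l * Var[(z · l); P]) / (A i k * A j k))
    fun t ↦ ?_
  have hzk : (fun ω ↦ t * z ω k) = (Pi.single k t ⬝ᵥ z ·) := by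
    simp [single_dotProduct]
  have hyk : (fun ω ↦ t * z ω k) = ((t • B k) ⬝ᵥ A *ᵥ z ·) := by
    ext ω
    have : B *ᵥ A *ᵥ z ω = z ω := by rw [Matrix.mulVec_mulVec, hBA, Matrix.one_mulVec]
    rw [smul_dotProduct, smul_eq_mul]
    exact congrArg (t * ·) (congrFun this k).symm
  have hsum : ∑ l, A i l * A j l * tiltedCov P (fun ω ↦ t * z ω k) (z · l) (z · l) = 0 := by
    rw [hzk, ← tiltedCov_dotProduct_dotProduct hz hz2, ← hzk, hyk]
    exact tiltedCov_dotProduct_eq_zero hy hym _ hij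
  have hne (l : ι) (hl : l ≠ k) : tiltedCov P (fun ω ↦ t * z ω k) (z · l) (z · l) =
      Var[(z · l); P] * (∫ ω, Complex.exp (↑(t * z ω k) * Complex.I) ∂P) ^ 2 := by
    rw [← covariance_self (hzm l)]
    exact tiltedCov_eq_covariance_mul_sq (hz2 l) (hz2 l) ((hzm k).const_mul t)
      ((hz.indepFun hl).comp (φ := fun x ↦ (x, x)) (ψ := (t * ·)) (by fun_prop) (by fun_prop))
  have hk' : (A i k * A j k : ℂ) ≠ 0 := by exact_mod_cast hk
  rw [← Finset.add_sum_erase _ _ (Finset.mem_univ k), Finset.sum_congr rfl fun l hl ↦ by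
    rw [hne l (Finset.ne_of_mem_erase hl), ← mul_assoc], ← Finset.sum_mul] at hsum
  push_cast at hsum ⊢
  rw [div_mul_eq_mul_div, eq_div_iff hk']
  linear_combination hsum

end Gaussian

/-- The coordinates of `z` are independent random variables of variance one: what remains of the
assumptions on standardized sources once their means are disregarded. -/
structure HasIndepUnitVarianceCoords {S ι : Type*} {mS : MeasurableSpace S} (P : Measure S)
    (z : S → ι → ℝ) : Prop where
  indep : iIndepFun (fun k ω ↦ z ω k) P
  memLp : ∀ k, MemLp (z · k) 2 P
  variance_eq_one : ∀ k, Var[(z · k); P] = 1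

namespace HasIndepUnitVarianceCoords

variable {S S' ι κ : Type*} {mS : MeasurableSpace S} {mS' : MeasurableSpace S'}
  {P : Measure S} {P' : Measure S'} {z : S → ι → ℝ} {z' : S' → ι → ℝ}

lemma of_identDistrib [Finite ι] (hz' : HasIndepUnitVarianceCoords P' z')
    (h : IdentDistrib z z' P P') : HasIndepUnitVarianceCoords P z := by
  have := Fintype.ofFinite ι
  have := hz'.indep.isProbabilityMeasure
  have hk (k : ι) : IdentDistrib (z · k) (z' · k) P P' := h.comp (measurable_pi_apply k)
  have : IsProbabilityMeasure P := by
    rw [← Measure.isProbabilityMeasure_map_iff h.aemeasurable_fst, h.map_eq]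
    exact Measure.isProbabilityMeasure_map h.aemeasurable_snd
  refine ⟨?_, fun k ↦ (hk k).memLp_iff.2 (hz'.memLp k),
    fun k ↦ (hk k).variance_eq.trans (hz'.variance_eq_one k)⟩
  rw [iIndepFun_iff_map_fun_eq_pi_map fun k ↦ (hk k).aemeasurable_fst]
  simp_rw [(hk _).map_eq]
  exact h.map_eq.trans (hz'.indep.map_fun_eq_pi_map fun k ↦ (hk k).aemeasurable_snd)

lemma covariance_eq_one_apply [DecidableEq ι] (hz : HasIndepUnitVarianceCoords P z) (i j : ι) :
    cov[(z · i), (z · j); P] = (1 : Matrix ι ι ℝ) i j := by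
  have := hz.indep.isProbabilityMeasure
  rcases eq_or_ne i j with rfl | hij
  · rw [covariance_self (hz.memLp i).aemeasurable, hz.variance_eq_one, Matrix.one_apply_eq]
  · rw [(hz.indep.indepFun hij).covariance_eq_zero (hz.memLp i) (hz.memLp j),
      Matrix.one_apply_ne hij]

lemma covariance_mulVec [Fintype ι] (hz : HasIndepUnitVarianceCoords P z) (A : Matrix κ ι ℝ)
    (i j : κ) : cov[fun ω ↦ (A *ᵥ z ω) i, fun ω ↦ (A *ᵥ z ω) j; P] = (A * Aᵀ) i j := by
  classical
  have := hz.indep.isProbabilityMeasure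
  have hterm (i : κ) (k : ι) : MemLp (fun ω ↦ A i k * z ω k) 2 P := (hz.memLp k).const_mul _
  simp only [Matrix.mulVec, dotProduct]
  rw [covariance_fun_sum_fun_sum (hterm i) (hterm j)]
  simp only [covariance_const_mul_left, covariance_const_mul_right, hz.covariance_eq_one_apply]
  simp [Matrix.mul_apply, Matrix.one_apply, mul_comm]

lemma mul_transpose_eq_one [Fintype ι] [DecidableEq κ] {A : Matrix κ ι ℝ}
    (hz : HasIndepUnitVarianceCoords P z) (hy : HasIndepUnitVarianceCoords P (A *ᵥ z ·)) :
    A * Aᵀ = 1 := by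
  ext i j
  rw [← hz.covariance_mulVec, hy.covariance_eq_one_apply]

end HasIndepUnitVarianceCoords

section SignedSingle

variable {R ι : Type*} [CommRing R] [Fintype ι] [DecidableEq ι] {v : ι → R}

lemma exists_eq_single_of_pairwise_mul_eq_zero [IsDomain R] (hv : v ⬝ᵥ v = 1)
    (h : Pairwise fun i j ↦ v i * v j = 0) :
    ∃ (i : ι) (ε : R), (ε = 1 ∨ ε = -1) ∧ v = Pi.single i ε := by
  obtain ⟨i, hi⟩ : ∃ i, v i ≠ 0 := by
    by_contra! hzero
    simp [dotProduct, hzero] at hv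
  have hsingle : v = Pi.single i (v i) := by
    ext j
    rcases eq_or_ne j i with rfl | hj
    · simp
    · simpa [hj, hi] using h hj
  refine ⟨i, v i, ?_, hsingle⟩
  rw [hsingle, single_dotProduct, Pi.single_eq_same] at hv
  exact mul_self_eq_one_iff.1 hv

lemma eq_single_of_dotProduct_self_eq_one [LinearOrder R] [IsStrictOrderedRing R]
    (hv : v ⬝ᵥ v = 1) {i : ι} (hi : v i = 1 ∨ v i = -1) : v = Pi.single i (v i) := by
  have hsum : ∑ j ∈ Finset.univ.erase i, v j * v j = 0 := by
    rw [dotProduct, ← Finset.add_sum_erase _ _ (Finset.mem_univ i),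
      mul_self_eq_one_iff.2 hi] at hv
    exact add_eq_left.1 hv
  rw [Finset.sum_eq_zero_iff_of_nonneg fun _ _ ↦ mul_self_nonneg _] at hsum
  ext j
  rcases eq_or_ne j i with rfl | hj
  · simp
  · simpa [hj] using hsum j (by simp [hj])

lemma exists_col_eq_single_and_row_eq_single [LinearOrder R] [IsStrictOrderedRing R]
    {A : Matrix ι ι R} (hA : A * Aᵀ = 1) {k : ι} (h : Pairwise fun i j ↦ A i k * A j k = 0) :
    ∃ (i : ι) (ε : R), (ε = 1 ∨ ε = -1) ∧ A.col k = Pi.single i ε ∧ A.row i = Pi.single k ε := by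
  have hA' : Aᵀ * A = 1 := mul_eq_one_comm.1 hA
  have hcol : A.col k ⬝ᵥ A.col k = 1 :=
    (congrFun (congrFun hA' k) k).trans (Matrix.one_apply_eq k)
  obtain ⟨i, ε, hε, hki⟩ := exists_eq_single_of_pairwise_mul_eq_zero hcol h
  have hik : A.row i k = ε := by simpa using congrFun hki i
  have hrow : A.row i ⬝ᵥ A.row i = 1 :=
    (congrFun (congrFun hA i) i).trans (Matrix.one_apply_eq i)
  exact ⟨i, ε, hε, hki, hik ▸ eq_single_of_dotProduct_self_eq_one hrow (hik ▸ hε)⟩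

end SignedSingle

namespace IsSignalSeparationModel

variable {S S' : Type*} {mS : MeasurableSpace S} {mS' : MeasurableSpace S'}
  {P : Measure S} {P' : Measure S'} {p d d' : ℕ} {μ μ' : Fin p → ℝ}
  {Ω Ω' : Matrix (Fin p) (Fin p) ℝ} {z x : S → Fin p → ℝ} {z' x' : S' → Fin p → ℝ}

lemma hasIndepUnitVarianceCoords (hx : IsSignalSeparationModel P d μ Ω z x) :
    HasIndepUnitVarianceCoords P z where
  indep := hx.indep
  memLp := hx.memLp
  variance_eq_one k := by
    rw [variance_of_integral_eq_zero (hx.memLp k).aemeasurable (hx.mean_eq_zero k)]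
    exact hx.second_moment_eq_one k

lemma integral_eq (hx : IsSignalSeparationModel P d μ Ω z x) (i : Fin p) :
    ∫ ω, x ω i ∂P = μ i := by
  have := hx.indep.isProbabilityMeasure
  have hterm (k : Fin p) : Integrable (fun ω ↦ Ω i k * z ω k) P :=
    ((hx.memLp k).integrable one_le_two).const_mul _
  have hobs : ∀ᵐ ω ∂P, x ω i = μ i + ∑ k, Ω i k * z ω k := by
    filter_upwards [hx.observed_eq] with ω hω
    rw [hω]
    rfl
  rw [integral_congr_ae hobs, integral_add (integrable_const _)
    (integrable_finsetSum _ fun k _ ↦ hterm k), integral_finsetSum _ fun k _ ↦ hterm k]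
  simp [integral_const_mul, hx.mean_eq_zero]

lemma ae_inv_mulVec_sub_eq (hx : IsSignalSeparationModel P d μ Ω z x) :
    ∀ᵐ ω ∂P, Ω⁻¹ *ᵥ (x ω - μ) = z ω := by
  filter_upwards [hx.observed_eq] with ω hω
  rw [hω, add_sub_cancel_left, Matrix.mulVec_mulVec, Matrix.nonsing_inv_mul _ hx.nonsingular,
    Matrix.one_mulVec]

lemma identDistrib_mulVec (hx : IsSignalSeparationModel P d μ Ω z x)
    (hx' : IsSignalSeparationModel P' d' μ' Ω' z' x') (hlaw : IdentDistrib x x' P P') :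
    IdentDistrib ((Ω'⁻¹ * Ω) *ᵥ z ·) z' P P' := by
  have hμ : μ = μ' := by
    ext i
    rw [← hx.integral_eq, ← hx'.integral_eq]
    exact (hlaw.comp (measurable_pi_apply i)).integral_eq
  have hinv : Measurable fun v : Fin p → ℝ ↦ Ω'⁻¹ *ᵥ (v - μ') := by fun_prop
  have hxz : ∀ᵐ ω ∂P, Ω'⁻¹ *ᵥ (x ω - μ') = (Ω'⁻¹ * Ω) *ᵥ z ω := by
    filter_upwards [hx.observed_eq] with ω hω
    rw [hω, hμ, add_sub_cancel_left, Matrix.mulVec_mulVec]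
  have hxz_law := IdentDistrib.of_ae_eq (hinv.comp_aemeasurable hlaw.aemeasurable_fst) hxz
  have hxz'_law := IdentDistrib.of_ae_eq (hinv.comp_aemeasurable hlaw.aemeasurable_snd)
    hx'.ae_inv_mulVec_sub_eq
  exact hxz_law.symm.trans ((hlaw.comp hinv).trans hxz'_law)

lemma exists_col_eq_single (hx : IsSignalSeparationModel P d μ Ω z x)
    (hx' : IsSignalSeparationModel P' d' μ' Ω' z' x') (hlaw : IdentDistrib x x' P P')
    {k : Fin p} (hk : k < d) :
    ∃ (i : Fin p) (ε : ℝ), i < d' ∧ (ε = 1 ∨ ε = -1) ∧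
      (Ω'⁻¹ * Ω).col k = Pi.single i ε ∧ (Ω'⁻¹ * Ω).row i = Pi.single k ε := by
  set A := Ω'⁻¹ * Ω
  have hyz' : IdentDistrib (A *ᵥ z ·) z' P P' := hx.identDistrib_mulVec hx' hlaw
  have hz := hx.hasIndepUnitVarianceCoords
  have hy := hx'.hasIndepUnitVarianceCoords.of_identDistrib hyz'
  have hA : A * Aᵀ = 1 := hz.mul_transpose_eq_one hy
  have hmul : Pairwise fun i j ↦ A i k * A j k = 0 := by
    intro i j hij
    by_contra hne
    exact hx.signal_nonGaussian k hk <|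
      hasGaussianLaw_of_iIndepFun_mulVec hz.indep hz.memLp (mul_eq_one_comm.1 hA) hy.indep hij hne
  obtain ⟨i, ε, hε, hcol, hrow⟩ := exists_col_eq_single_and_row_eq_single hA hmul
  refine ⟨i, ε, ?_, hε, hcol, hrow⟩
  by_contra! hi
  have hyi : HasGaussianLaw (fun ω ↦ (A *ᵥ z ω) i) P :=
    ⟨(hyz'.comp (measurable_pi_apply i)).map_eq ▸ (hx'.noise_gaussian i hi).isGaussian_map⟩
  refine hx.signal_nonGaussian k hk ((hyi.fun_smul ε).congr (.of_forall fun ω ↦ ?_))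
  have hyz : (A *ᵥ z ω) i = ε * z ω k := by
    rw [← single_dotProduct, ← hrow]
    rfl
  simp only [hyz, smul_eq_mul, ← mul_assoc, mul_self_eq_one_iff.2 hε, one_mul]

lemma exists_injective_signalBlock_eq (hd : d ≤ p) (hd' : d' ≤ p)
    (hx : IsSignalSeparationModel P d μ Ω z x)
    (hx' : IsSignalSeparationModel P' d' μ' Ω' z' x') (hlaw : IdentDistrib x x' P P') :
    ∃ (τ : Fin d → Fin d') (ε : Fin d → ℝ), Function.Injective τ ∧ (∀ k, ε k = 1 ∨ ε k = -1) ∧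
      ∀ i k, signalBlock hd Ω i k = ε k * signalBlock hd' Ω' i (τ k) := by
  choose τ ε hτ hε hcol hrow using
    fun k : Fin d ↦ hx.exists_col_eq_single hx' hlaw (k := k.castLE hd) k.isLt
  refine ⟨fun k ↦ ⟨τ k, hτ k⟩, ε, fun k l hkl ↦ ?_, hε, fun i k ↦ ?_⟩
  · have hτkl : τ k = τ l := Fin.ext (Fin.mk.inj_iff.1 hkl)
    have hεk : ε k = (Pi.single (l.castLE hd) (ε l) : Fin p → ℝ) (k.castLE hd) := by
      rw [← hrow l, ← hτkl, hrow k, Pi.single_eq_same]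
    have hεk_ne : ε k ≠ 0 := by rcases hε k with h | h <;> simp [h]
    by_contra hne
    exact hεk_ne (by simpa [hne] using hεk)
  · have hΩ : Ω' * (Ω'⁻¹ * Ω) = Ω := Matrix.mul_nonsing_inv_cancel_left _ _ hx'.nonsingular
    calc Ω i (k.castLE hd) = (Ω' * (Ω'⁻¹ * Ω)) i (k.castLE hd) := by rw [hΩ]
      _ = Ω' i ⬝ᵥ (Ω'⁻¹ * Ω).col (k.castLE hd) := rfl
      _ = ε k * Ω' i (τ k) := by rw [hcol, dotProduct_single, mul_comm]

end IsSignalSeparationModel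

theorem corollary1_general {p d d' : ℕ} (hd : d ≤ p) (hd' : d' ≤ p)
    {S : Type*} [MeasurableSpace S] (P : Measure S) {S' : Type*} [MeasurableSpace S']
    (P' : Measure S') (μ μ' : Fin p → ℝ) (Ω Ω' : Matrix (Fin p) (Fin p) ℝ)
    (z x : S → Fin p → ℝ) (z' x' : S' → Fin p → ℝ)
    (hx : IsSignalSeparationModel P d μ Ω z x)
    (hx' : IsSignalSeparationModel P' d' μ' Ω' z' x')
    (hlaw : IdentDistrib x x' P P') :
    ∃ (σ : Fin d' ≃ Fin d) (ε : Fin d' → ℝ),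
      (∀ j, ε j = 1 ∨ ε j = -1) ∧
      ∀ i j, signalBlock hd' Ω' i j = ε j * signalBlock hd Ω i (σ j) := by
  obtain ⟨τ, -, hτ, -⟩ := hx.exists_injective_signalBlock_eq hd hd' hx' hlaw
  obtain ⟨σ, ε, hσ, hε, hblock⟩ := hx'.exists_injective_signalBlock_eq hd' hd hx hlaw.symm
  have hcard : Fintype.card (Fin d') = Fintype.card (Fin d) :=
    le_antisymm (Fintype.card_le_of_injective σ hσ) (Fintype.card_le_of_injective τ hτ)
  exact ⟨.ofBijective σ ((Fintype.bijective_iff_injective_and_card σ).2 ⟨hσ, hcard⟩), ε, hε, hblock⟩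

theorem corollary1 {p d : ℕ} (hd : d ≤ p)
    {S : Type*} [MeasurableSpace S] (P : Measure S) [IsProbabilityMeasure P]
    {S' : Type*} [MeasurableSpace S'] (P' : Measure S') [IsProbabilityMeasure P']
    (μ μ' : Fin p → ℝ) (Ω Ω' : Matrix (Fin p) (Fin p) ℝ)
    (z x : S → Fin p → ℝ) (z' x' : S' → Fin p → ℝ)
    (hx : IsSignalSeparationModel P d μ Ω z x)
    (hx' : IsSignalSeparationModel P' d μ' Ω' z' x')
    (hlaw : IdentDistrib x x' P P') :
    ∃ (σ : Equiv.Perm (Fin d)) (ε : Fin d → ℝ),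
      (∀ j, ε j = 1 ∨ ε j = -1) ∧
      ∀ i j, signalBlock hd Ω' i j = ε j * signalBlock hd Ω i (σ j) :=
  corollary1_general hd hd P P' μ μ' Ω Ω' z x z' x' hx hx' hlaw
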